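/- Let $A$ be a simple Euclidean Jordan algebra over $\mathbb R$ (finite-dimensional, with unit $e$) of rank $3$, and let $c_1,c_2,c_3$ be a complete system of mutually orthogonal primitive idempotents of $A$ (so $c_ic_j=0$ for $i\ne j$ and $c_1+c_2+c_3=e$). For an element $x=\sum_i\lambda_i d_i$, where the $d_i$ form a complete system of mutually orthogonal primitive idempotents and $\lambda_i\in\mathbb R$ (the eigenvalues of $x$), put $\operatorname{tr}(x)=\sum_i\lambda_i$ and $\det(x)=\prod_i\lambda_i$; let $(x,y)=\operatorname{tr}(xy)$ and $\|x\|^2=(x,x)$, and let $\Omega_3$ be the cone of elements of $A$ all of whose eigenvalues are positive. Let $A_0=\{x\in A: c_3x=0\}$, a Jordan algebra of rank $2$ with unit $c_1+c_2$, and $A_{1/2}=\{x\in A: c_3x=\tfrac12x\}$. For $z\in A_0$, the quantities $\operatorname{tr}(z)$, $\det(z)$ and $z^{-1}$ are taken in the algebra $A_0$. Let $z\in A_0$, $\xi\in A_{1/2}$, $t\in\mathbb R$ and suppose that $y=z+\xi+t c_3\in\Omega_3$. Then $y$ is invertible in $A$, $z$ is invertible in $A_0$, the denominator below is nonzero, and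 $$\operatorname{tr}(y^{-1})=\frac{2\det(z)+2t\operatorname{tr}(z)-\|\xi\|^2}{2\det(z)\,\bigl[t-(z^{-1}\xi,\xi)\bigr]}.$$ -/

import Mathlib

namespace EuclideanJordan

/-- The powers `x ^ 0 = e`, `x ^ (k + 1) = x (x ^ k)` in a unital non-associative algebra. -/
def pow {A : Type*} [NonAssocCommRing A] (x : A) : ℕ → A
  | 0 => 1
  | k + 1 => x * pow x k

/-- The subspace `ℝ[x]` spanned by the powers of `x`. -/
def powers {A : Type*} [NonAssocCommRing A] [Module ℝ A] (x : A) : Submodule ℝ A :=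
  Submodule.span ℝ (Set.range (pow x))

/-- The degree of the minimal polynomial of `x`, that is the dimension of `ℝ[x]`. -/
noncomputable def degree {A : Type*} [NonAssocCommRing A] [Module ℝ A] (x : A) : ℕ :=
  Module.finrank ℝ (powers x)

/-- The rank of `A` is `r`: the largest degree of a minimal polynomial of an element is `r`. -/
def HasRank (A : Type*) [NonAssocCommRing A] [Module ℝ A] (r : ℕ) : Prop :=
  IsGreatest (Set.range (degree : A → ℕ)) r

/-- A real algebra is Euclidean if it carries an inner product (a positive definite symmetric
bilinear form) for which all multiplications are self-adjoint. -/
def IsEuclidean (A : Type*) [NonAssocCommRing A] [Module ℝ A] : Prop :=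
  ∃ B : A →ₗ[ℝ] A →ₗ[ℝ] ℝ, (∀ x y, B x y = B y x) ∧ (∀ x, x ≠ 0 → 0 < B x x) ∧
    ∀ x y z, B (x * y) z = B y (x * z)

/-- A primitive idempotent: a nonzero idempotent that is not a sum of two nonzero idempotents. -/
structure IsPrimitiveIdempotent {A : Type*} [NonAssocCommRing A] (c : A) : Prop where
  idem : IsIdempotentElem c
  ne_zero : c ≠ 0
  primitive : ∀ a b : A, IsIdempotentElem a → IsIdempotentElem b → a + b = c → a = 0 ∨ b = 0

/-- A complete system of mutually orthogonal primitive idempotents (a Jordan frame). -/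
structure IsJordanFrame {A : Type*} [NonAssocCommRing A] {r : ℕ} (c : Fin r → A) : Prop where
  primitive : ∀ i, IsPrimitiveIdempotent (c i)
  orthogonal : ∀ i j, i ≠ j → c i * c j = 0
  complete : ∑ i, c i = 1

/-- `s` is the family, with multiplicities, of the coefficients `λ i` in a spectral decomposition
`x = ∑ i, λ i • c i` along a Jordan frame `c`. -/
def HasEigenvalues {A : Type*} [NonAssocCommRing A] [Module ℝ A] (x : A)
    (s : Multiset ℝ) : Prop :=
  ∃ (r : ℕ) (c : Fin r → A) (l : Fin r → ℝ),
    IsJordanFrame c ∧ x = ∑ i, l i • c i ∧ s = Finset.univ.val.map l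

open Classical in
/-- The eigenvalues of `x`, with multiplicities. By the spectral theorem every element of a
Euclidean Jordan algebra has exactly one such multiset, so that the second case does not occur
there. -/
noncomputable def eigenvalues {A : Type*} [NonAssocCommRing A] [Module ℝ A] (x : A) :
    Multiset ℝ :=
  if h : ∃ s, HasEigenvalues x s then h.choose else 0

/-- The trace of `x`: the sum of its eigenvalues. -/
noncomputable def trace {A : Type*} [NonAssocCommRing A] [Module ℝ A] (x : A) : ℝ :=
  (eigenvalues x).sum

/-- The determinant of `x`: the product of its eigenvalues. -/
noncomputable def det {A : Type*} [NonAssocCommRing A] [Module ℝ A] (x : A) : ℝ :=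
  (eigenvalues x).prod

/-- The inner product `(x, y) = tr (x y)`. -/
noncomputable def traceForm {A : Type*} [NonAssocCommRing A] [Module ℝ A] (x y : A) : ℝ :=
  trace (x * y)

/-- The cone of positivity: the elements all of whose eigenvalues are positive. -/
def positiveCone (A : Type*) [NonAssocCommRing A] [Module ℝ A] : Set A :=
  {x | ∃ s, HasEigenvalues x s ∧ ∀ a ∈ s, 0 < a}

/-- `y` is the inverse of `x`: it lies in `ℝ[x]` and satisfies `x y = e`. -/
def IsInverse {A : Type*} [NonAssocCommRing A] [Module ℝ A] (x y : A) : Prop :=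
  y ∈ powers x ∧ x * y = 1

/-- `x` is invertible in the Jordan algebra. -/
def IsInvertible {A : Type*} [NonAssocCommRing A] [Module ℝ A] (x : A) : Prop :=
  ∃ y, IsInverse x y

open Classical in
/-- The inverse of `x` in the Jordan algebra (`0` if `x` is not invertible). -/
noncomputable def inv {A : Type*} [NonAssocCommRing A] [Module ℝ A] (x : A) : A :=
  if h : IsInvertible x then h.choose else 0

/-- The Peirce space `A_a`, the eigenspace of `L(c)` for the eigenvalue `a`. -/
def peirceSpace {A : Type*} [NonAssocCommRing A] [Module ℝ A] [SMulCommClass ℝ A A]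
    [IsScalarTower ℝ A A] (c : A) (a : ℝ) : Submodule ℝ A :=
  Module.End.eigenspace (LinearMap.mulLeft ℝ c) a

theorem mem_peirceSpace {A : Type*} [NonAssocCommRing A] [Module ℝ A] [SMulCommClass ℝ A A]
    [IsScalarTower ℝ A A] {c x : A} {a : ℝ} : x ∈ peirceSpace c a ↔ c * x = a • x := by
  simp [peirceSpace]

theorem mul_mem_peirceSpace_zero {A : Type*} [NonAssocCommRing A] [Module ℝ A]
    [SMulCommClass ℝ A A] [IsScalarTower ℝ A A] [IsCommJordan A] {c x y : A}
    (hc : IsIdempotentElem c) (hx : x ∈ peirceSpace c 0) (hy : y ∈ peirceSpace c 0) :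
    x * y ∈ peirceSpace c 0 := by
  rw [mem_peirceSpace, zero_smul] at *
  have hxc : x * c = 0 := by rw [mul_comm]; exact hx
  have h := two_nsmul_lie_lmul_lmul_add_add_eq_zero x c c
  rw [hc.eq, hx, hxc] at h
  simp only [map_zero, Ring.lie_def, mul_zero, zero_mul, sub_zero, add_zero] at h
  have h1 : (2 : ℕ) • (x * (c * y) - c * (x * y)) = 0 := DFunLike.congr_fun h y
  rw [hy, mul_zero, zero_sub, ← Nat.cast_smul_eq_nsmul ℝ] at h1
  simpa using h1

/-- The Peirce subalgebra `A_0` of an idempotent `c`. -/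
def peirceZero {A : Type*} [NonAssocCommRing A] [Module ℝ A] [SMulCommClass ℝ A A]
    [IsScalarTower ℝ A A] [IsCommJordan A] (c : A) (hc : IsIdempotentElem c) :
    NonUnitalSubalgebra ℝ A :=
  { peirceSpace c 0 with
    mul_mem' := fun hx hy => mul_mem_peirceSpace_zero hc hx hy }

theorem mem_peirceZero {A : Type*} [NonAssocCommRing A] [Module ℝ A] [SMulCommClass ℝ A A]
    [IsScalarTower ℝ A A] [IsCommJordan A] {c x : A} {hc : IsIdempotentElem c} :
    x ∈ peirceZero c hc ↔ c * x = 0 := by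
  change x ∈ peirceSpace c 0 ↔ _
  rw [mem_peirceSpace, zero_smul]

/-- `A_0` is a unital algebra with unit `e - c`. -/
instance {A : Type*} [NonAssocCommRing A] [Module ℝ A] [SMulCommClass ℝ A A]
    [IsScalarTower ℝ A A] [IsCommJordan A] (c : A) (hc : IsIdempotentElem c) :
    NonAssocCommRing (peirceZero c hc) :=
  { (inferInstance : NonUnitalNonAssocCommRing (peirceZero c hc)) with
    one := ⟨1 - c, mem_peirceZero.2 (by rw [mul_sub, mul_one, hc.eq, sub_self])⟩
    one_mul := fun x => Subtype.ext (by
      change (1 - c) * (x : A) = x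
      rw [sub_mul, one_mul, mem_peirceZero.1 x.2, sub_zero])
    mul_one := fun x => Subtype.ext (by
      change (x : A) * (1 - c) = x
      rw [mul_sub, mul_one, mul_comm (x : A) c, mem_peirceZero.1 x.2, sub_zero]) }

end EuclideanJordan

namespace EuclideanJordan

/-! If `y` has eigenvalues `m i`, then tr(y⁻¹) is the quotient of their second and third elementary
symmetric functions. By Newton's identities these are determined by the power sums tr(y), tr(y²),
tr(y³), which can be read off the Peirce decomposition y = z + ξ + t c₃ (`peirce_sq`,
`peirce_cube`). Besides the eigenvalues of `z` and `t`, only (ξ,ξ) and (zξ,ξ) enter. The second is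
traded for (z⁻¹ξ,ξ) by Cayley-Hamilton in rank 2, det(z) z⁻¹ = tr(z)(e - c₃) - z, since e - c₃ acts
on ξ as 1/2. Positivity of the eigenvalues of `z` follows by pairing `y` with the idempotents of
`z`.

For this the trace must be linear and its form associative. Both come from `exists_normalized`: a
multiple `B` of the given inner product has B(d,1) = 1 for every member `d` of every Jordan frame,
so tr(x) = B(x,1) whichever spectral decomposition is chosen. Within a frame the values agree
because the algebra is simple (`apply_one_eq`); across frames they agree because all frames have
length 3 (`frame_length`). -/

theorem one_sub_mul_one_sub {A : Type*} [NonAssocCommRing A] {e : A} (he : e * e = e) :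
    (1 - e) * (1 - e) = 1 - e := by
  simp [mul_sub, sub_mul, he]

/-! ### Peirce calculus of an idempotent -/

section Peirce

variable {A : Type*} [NonAssocCommRing A] [Module ℝ A] [IsCommJordan A]

/-- The full linearization of the Jordan identity. -/
theorem jordan_linearized (a b c d : A) :
    a * ((b * c) * d) + b * ((c * a) * d) + c * ((a * b) * d) =
      (b * c) * (a * d) + (c * a) * (b * d) + (a * b) * (c * d) := by
  have h : (2 : ℕ) • ((a * ((b * c) * d) - (b * c) * (a * d)) +
      (b * ((c * a) * d) - (c * a) * (b * d)) + (c * ((a * b) * d) - (a * b) * (c * d))) = 0 :=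
    DFunLike.congr_fun (two_nsmul_lie_lmul_lmul_add_add_eq_zero a b c) d
  rw [← Nat.cast_smul_eq_nsmul ℝ] at h
  have h := (smul_eq_zero_iff_right (by norm_num)).1 h
  rw [← sub_eq_zero, ← h]
  abel

/-- In the linearized identity at x, e, e all terms containing `e * x` vanish. Applied also to `1 -
e`, this yields the Peirce rules for A_0 and A_1. -/
theorem mul_left_comm_of_mul_eq_zero {e x : A} (he : e * e = e) (hx : e * x = 0) (v : A) :
    e * (x * v) = x * (e * v) := by
  have h := jordan_linearized x e e v
  rw [he, hx, mul_comm x e, hx] at h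
  simpa using h.symm

theorem mul_mul_eq_zero {e x y : A} (he : e * e = e) (hx : e * x = 0) (hy : e * y = 0) :
    e * (x * y) = 0 := by
  rw [mul_left_comm_of_mul_eq_zero he hx, hy, mul_zero]

theorem mul_mul_eq_self {e x y : A} (he : e * e = e) (hx : e * x = x) (hy : e * y = y) :
    e * (x * y) = x * y := by
  have h := mul_mul_eq_zero (one_sub_mul_one_sub he) (x := x) (y := y) (by simp [sub_mul, hx])
    (by simp [sub_mul, hy])
  rw [sub_mul, one_mul, sub_eq_zero] at h
  exact h.symm

/-- Commuting `e` past `x` puts the product in A_1; commuting `1 - e` past `y` puts it in A_0. -/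
theorem mul_eq_zero_of_peirce {e x y : A} (he : e * e = e) (hx : e * x = 0) (hy : e * y = y) :
    x * y = 0 := by
  have h := mul_left_comm_of_mul_eq_zero he hx y
  have h' := mul_left_comm_of_mul_eq_zero (one_sub_mul_one_sub he) (x := y)
    (by simp [sub_mul, hy]) x
  rw [hy] at h
  rw [sub_mul, sub_mul, hx, mul_comm y x, h] at h'
  simpa [mul_comm y x] using h'.symm

theorem peirce_polynomial {e : A} (he : e * e = e) (x : A) :
    (2 : ℝ) • (e * (e * (e * x))) + e * x = (3 : ℝ) • (e * (e * x)) := by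
  have h := jordan_linearized e e x e
  simp only [he, mul_comm x e, mul_comm (e * x) e] at h
  linear_combination (norm := module) h

/-- 2L² - L takes the values 0, 0, 1 at 0, 1/2, 1, so it is the projection onto A_1. -/
theorem mul_mul_mul_of_orthogonal_aux {e : A} (he : e * e = e) (v : A)
    [SMulCommClass ℝ A A] :
    e * ((2 : ℝ) • (e * (e * v)) - e * v) = (2 : ℝ) • (e * (e * v)) - e * v := by
  rw [mul_sub, mul_smul_comm]
  linear_combination (norm := module) peirce_polynomial he v

/-- Products of multiplications by orthogonal idempotents land in the mixed Peirce space. -/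
theorem mul_mul_mul_of_orthogonal [SMulCommClass ℝ A A] {e f : A} (he : e * e = e)
    (hef : e * f = 0) (v : A) :
    e * (e * (f * v)) = (1 / 2 : ℝ) • (e * (f * v)) := by
  have hc := mul_left_comm_of_mul_eq_zero he hef
  -- `f` lies in A_0(e), hence annihilates the A_1(e)-component of `v`.
  have h2 := mul_eq_zero_of_peirce he hef (mul_mul_mul_of_orthogonal_aux he v)
  rw [mul_sub, mul_smul_comm, ← hc, ← hc, sub_eq_zero] at h2
  linear_combination (norm := module) (1 / 2 : ℝ) • h2

variable [SMulCommClass ℝ A A] [IsScalarTower ℝ A A]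

theorem mul_sq_comm_of_half {e x : A} (hx : e * x = (1 / 2 : ℝ) • x) (v : A) :
    e * ((x * x) * v) = (x * x) * (e * v) := by
  have h := jordan_linearized e x x v
  rw [mul_comm x e, hx] at h
  simp only [smul_mul_assoc, mul_smul_comm] at h
  linear_combination (norm := module) h

theorem mul_mul_sq_of_half {e x : A} (he : e * e = e) (hx : e * x = (1 / 2 : ℝ) • x) :
    e * (e * (x * x)) = e * (x * x) := by
  have h := mul_sq_comm_of_half hx e
  rwa [he, mul_comm (x * x) e] at h

end Peirce

/-! ### Power associativity -/

section PowerAssociative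

open Polynomial

variable {A : Type*} [NonAssocCommRing A] [Module ℝ A] [SMulCommClass ℝ A A]

/-- The value at `x` of a polynomial. -/
noncomputable def evalAt (x : A) : ℝ[X] →ₗ[ℝ] A :=
  (LinearMap.applyₗ (1 : A)).comp (aeval (LinearMap.mulLeft ℝ x)).toLinearMap

theorem evalAt_apply (x : A) (p : ℝ[X]) : evalAt x p = aeval (LinearMap.mulLeft ℝ x) p 1 := rfl

theorem evalAt_X_pow (x : A) (k : ℕ) : evalAt x (X ^ k) = pow x k := by
  induction k with
  | zero => simp [evalAt_apply, pow]
  | succ k ih =>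
    rw [evalAt_apply, pow_succ', map_mul, Module.End.mul_apply, ← evalAt_apply, ih, aeval_X]
    rfl

theorem range_evalAt (x : A) : LinearMap.range (evalAt x) = powers x := by
  rw [← Submodule.map_top, ← (basisMonomials ℝ).span_eq, Submodule.map_span, ← Set.range_comp,
    powers]
  congr 2
  ext k
  simp [← evalAt_X_pow, X_pow_eq_monomial]

theorem evalAt_mem_powers (x : A) (p : ℝ[X]) : evalAt x p ∈ powers x :=
  range_evalAt x ▸ LinearMap.mem_range_self _ p

variable [IsCommJordan A]

/-- The linearized identity at x, x^k, v writes L(x^(k+2)) through L(x), L(x²), L(x^k) and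
L(x^(k+1)), all of which commute with L(x) by induction. -/
theorem commute_mulLeft_pow (x : A) (k : ℕ) :
    ∀ v, x * (pow x k * v) = pow x k * (x * v) := by
  induction k using Nat.twoStepInduction with
  | zero => simp [pow]
  | one => simp [pow]
  | more k h1 h2 =>
    have h0 : ∀ v, x * ((x * x) * v) = (x * x) * (x * v) := fun v => by
      have := jordan_linearized x x x v
      have h3 : (3 : ℝ) • (x * ((x * x) * v)) = (3 : ℝ) • ((x * x) * (x * v)) := by
        linear_combination (norm := module) this
      exact smul_right_injective A (by norm_num : (3 : ℝ) ≠ 0) h3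
    have key : ∀ v, pow x (k + 2) * v = (x * x) * (pow x k * v) + (2 : ℝ) • (pow x (k + 1) * (x * v))
        - x * (x * (pow x k * v)) - pow x k * (x * (x * v)) := fun v => by
      have h := jordan_linearized x (pow x k) v x
      have e1 : pow x (k + 1) = x * pow x k := rfl
      have e2 : pow x (k + 2) = x * (x * pow x k) := rfl
      rw [e1] at *
      rw [e2]
      simp only [mul_comm v x, mul_comm (pow x k) x, mul_comm (x * v) x,
        mul_comm (x * pow x k) x, mul_comm v (x * (x * pow x k)), mul_comm (pow x k * v) x,
        mul_comm (pow x k * v) (x * x), mul_comm (x * v) (x * pow x k)] at h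
      linear_combination (norm := module) h
    intro v
    rw [key, key]
    simp only [mul_add, mul_sub, mul_smul_comm, h0, h1, h2]

variable [IsScalarTower ℝ A A]

theorem evalAt_mul_comm (x : A) (p : ℝ[X]) (v : A) :
    x * (evalAt x p * v) = evalAt x p * (x * v) := by
  induction p using Polynomial.induction_on' with
  | add p q hp hq => simp only [map_add, add_mul, mul_add, hp, hq]
  | monomial k a =>
    rw [← smul_X_eq_monomial, map_smul, evalAt_X_pow]
    simp only [smul_mul_assoc, mul_smul_comm, commute_mulLeft_pow]

/-- L(p(x)) commutes with L(x), hence with q(L(x)); evaluate both orders at the unit. -/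
theorem evalAt_mul (x : A) (p q : ℝ[X]) : evalAt x p * evalAt x q = evalAt x (q * p) := by
  have h : Commute (LinearMap.mulLeft ℝ (evalAt x p)) (aeval (LinearMap.mulLeft ℝ x) q) := by
    exact Algebra.commute_of_mem_adjoin_singleton_of_commute
      (aeval_mem_adjoin_singleton ℝ (LinearMap.mulLeft ℝ x))
      (LinearMap.ext fun v => (evalAt_mul_comm x p v).symm)
  have h1 := DFunLike.congr_fun h.eq (1 : A)
  simp only [Module.End.mul_apply, LinearMap.mulLeft_apply, mul_one] at h1
  rw [evalAt_apply x q, h1, evalAt_apply, evalAt_apply, map_mul, Module.End.mul_apply]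

end PowerAssociative

/-! ### Associative inner products and systems of idempotents -/

open Polynomial

/-- `B` is an inner product for which all multiplications are self-adjoint. -/
structure IsAssociativeInner {A : Type*} [NonAssocCommRing A] [Module ℝ A]
    (B : A →ₗ[ℝ] A →ₗ[ℝ] ℝ) : Prop where
  symm : ∀ x y, B x y = B y x
  pos : ∀ x, x ≠ 0 → 0 < B x x
  assoc : ∀ x y z, B (x * y) z = B y (x * z)

/-- A symmetric operator for a positive definite form is diagonalizable. -/
theorem iSup_eigenspace_eq_top {V : Type*} [AddCommGroup V] [Module ℝ V] [Module.Finite ℝ V]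
    (B : V →ₗ[ℝ] V →ₗ[ℝ] ℝ) (symm : ∀ x y, B x y = B y x) (pos : ∀ x, x ≠ 0 → 0 < B x x)
    (T : Module.End ℝ V) (hT : ∀ x y, B (T x) y = B x (T y)) :
    ⨆ μ, T.eigenspace μ = ⊤ := by
  let cd : InnerProductSpace.Core ℝ V :=
    { inner := fun x y => B x y
      conj_inner_symm := fun x y => symm y x
      re_inner_nonneg := fun x => by
        rcases eq_or_ne x 0 with rfl | h
        · simp
        · exact (pos x h).le
      add_left := fun x y z => by simp
      smul_left := fun x y r => by simp
      definite := fun x h => by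
        by_contra h0
        exact (pos x h0).ne' h }
  let _ := cd.toNormedAddCommGroup
  let _ := InnerProductSpace.ofCore cd.toCore
  have hs : LinearMap.IsSymmetric (𝕜 := ℝ) T := fun x y => hT x y
  exact Submodule.orthogonal_eq_bot_iff.1 hs.orthogonalComplement_iSup_eigenspaces_eq_bot

/-- A complete system of mutually orthogonal nonzero idempotents. -/
structure IsCompleteSystem {A : Type*} [NonAssocCommRing A] {ι : Type*} [Fintype ι]
    (d : ι → A) : Prop where
  idem : ∀ i, d i * d i = d i
  ne_zero : ∀ i, d i ≠ 0
  orthogonal : ∀ i j, i ≠ j → d i * d j = 0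
  complete : ∑ i, d i = 1

theorem IsJordanFrame.isCompleteSystem {A : Type*} [NonAssocCommRing A] {r : ℕ} {c : Fin r → A}
    (hc : IsJordanFrame c) : IsCompleteSystem c :=
  ⟨fun i => (hc.primitive i).idem, fun i => (hc.primitive i).ne_zero, hc.orthogonal, hc.complete⟩

section System

variable {A : Type*} [NonAssocCommRing A] [Module ℝ A] [SMulCommClass ℝ A A]
  {ι : Type*} [Fintype ι] {d : ι → A}

theorem IsCompleteSystem.mul_sum_smul (hd : IsCompleteSystem d) (l : ι → ℝ) (i : ι) :
    d i * ∑ j, l j • d j = l i • d i := by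
  rw [Finset.mul_sum, Finset.sum_eq_single i]
  · rw [mul_smul_comm, hd.idem]
  · intro j _ hj
    rw [mul_smul_comm, hd.orthogonal i j hj.symm, smul_zero]
  · simp

theorem IsCompleteSystem.linearIndependent (hd : IsCompleteSystem d) :
    LinearIndependent ℝ d := by
  rw [Fintype.linearIndependent_iff]
  intro g hg i
  have h := hd.mul_sum_smul g i
  rw [hg, mul_zero] at h
  exact (smul_eq_zero.1 h.symm).resolve_right (hd.ne_zero i)

variable [IsScalarTower ℝ A A]

theorem IsCompleteSystem.sum_smul_mul_sum_smul (hd : IsCompleteSystem d) (l m : ι → ℝ) :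
    (∑ i, l i • d i) * ∑ i, m i • d i = ∑ i, (l i * m i) • d i := by
  rw [Finset.sum_mul]
  refine Finset.sum_congr rfl fun i _ => ?_
  rw [smul_mul_assoc, hd.mul_sum_smul, smul_smul]

theorem IsCompleteSystem.evalAt_sum_smul (hd : IsCompleteSystem d) (l : ι → ℝ) (p : ℝ[X]) :
    evalAt (∑ i, l i • d i) p = ∑ i, p.eval (l i) • d i := by
  induction p using Polynomial.induction_on' with
  | add p q hp hq => simp only [map_add, hp, hq, eval_add, add_smul, Finset.sum_add_distrib]
  | monomial k a =>
    rw [← smul_X_eq_monomial, map_smul, evalAt_X_pow]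
    simp only [eval_smul, smul_eq_mul, ← smul_smul, ← Finset.smul_sum, eval_pow, eval_X]
    congr 1
    induction k with
    | zero => simp [pow, hd.complete]
    | succ k ih =>
      rw [pow, ih, hd.sum_smul_mul_sum_smul]
      simp only [pow_succ']

theorem IsCompleteSystem.isInverse (hd : IsCompleteSystem d) {l : ι → ℝ} (hl : ∀ i, l i ≠ 0) :
    IsInverse (∑ i, l i • d i) (∑ i, (l i)⁻¹ • d i) := by
  classical
  constructor
  -- Interpolate a ↦ a⁻¹. The nodes are the set of values of `l`, so repeated coefficients do no
  -- harm.
  · convert evalAt_mem_powers (∑ i, l i • d i)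
      (Lagrange.interpolate (Finset.univ.image l) id (fun a => a⁻¹)) using 1
    rw [hd.evalAt_sum_smul]
    refine Finset.sum_congr rfl fun i _ => ?_
    rw [show l i = id (l i) from rfl, Lagrange.eval_interpolate_at_node _ Function.injective_id.injOn
      (Finset.mem_image_of_mem l (Finset.mem_univ i))]
    rfl
  · rw [hd.sum_smul_mul_sum_smul, ← hd.complete]
    exact Finset.sum_congr rfl fun i _ => by rw [mul_inv_cancel₀ (hl i), one_smul]

/-- The chosen inverse is p(x) for some polynomial `p`, and x p(x) = 1 forces p(l i) = (l i)⁻¹. -/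
theorem IsCompleteSystem.inv_eq (hd : IsCompleteSystem d) {l : ι → ℝ} (hl : ∀ i, l i ≠ 0) :
    inv (∑ i, l i • d i) = ∑ i, (l i)⁻¹ • d i := by
  have h : IsInvertible (∑ i, l i • d i) := ⟨_, hd.isInverse hl⟩
  rw [inv, dif_pos h]
  obtain ⟨h1, h2⟩ := h.choose_spec
  rw [← range_evalAt] at h1
  obtain ⟨p, hp⟩ := h1
  rw [← hp, hd.evalAt_sum_smul, hd.sum_smul_mul_sum_smul] at h2
  rw [← hp, hd.evalAt_sum_smul]
  refine Finset.sum_congr rfl fun i _ => ?_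
  have h3 := hd.mul_sum_smul (fun i => l i * p.eval (l i)) i
  rw [h2, mul_one] at h3
  have h4 : l i * p.eval (l i) = 1 := by
    by_contra h
    refine hd.ne_zero i ((smul_eq_zero.1 (?_ : (l i * p.eval (l i) - 1) • d i = 0)).resolve_left
      (sub_ne_zero.2 h))
    rw [sub_smul, one_smul, ← h3, sub_self]
  rw [eq_inv_of_mul_eq_one_right h4]

/-- With distinct coefficients, Lagrange basis polynomials recover each `d i` inside ℝ[x]. -/
theorem IsCompleteSystem.card_le_degree [Module.Finite ℝ A] (hd : IsCompleteSystem d)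
    {l : ι → ℝ} (hl : Function.Injective l) : Fintype.card ι ≤ degree (∑ i, l i • d i) := by
  classical
  rw [degree, ← finrank_span_eq_card hd.linearIndependent]
  refine Submodule.finrank_mono (Submodule.span_le.2 ?_)
  rintro _ ⟨i, rfl⟩
  have h := evalAt_mem_powers (∑ i, l i • d i) (Lagrange.basis Finset.univ l i)
  have h1 : ∑ j, (Lagrange.basis Finset.univ l i).eval (l j) • d j = d i := by
    rw [Finset.sum_eq_single i]
    · rw [Lagrange.eval_basis_self hl.injOn (Finset.mem_univ i), one_smul]
    · intro j _ hj
      rw [Lagrange.eval_basis_of_ne hj.symm (Finset.mem_univ j), zero_smul]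
    · simp
  rwa [hd.evalAt_sum_smul, h1] at h

end System

/-! ### Spectral theorem and Jordan frames -/

section Spectral

variable {A : Type*} [NonAssocCommRing A] [Module ℝ A] [SMulCommClass ℝ A A]
  [IsScalarTower ℝ A A] [IsCommJordan A] [Module.Finite ℝ A] {B : A →ₗ[ℝ] A →ₗ[ℝ] ℝ}

/-- Spectral decomposition along the idempotents of `ℝ[x]`. -/
theorem IsAssociativeInner.exists_spectral (hB : IsAssociativeInner B) (x : A) :
    ∃ (S : Finset ℝ) (f : S → A), IsCompleteSystem f ∧ x = ∑ μ : S, (μ : ℝ) • f μ ∧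
      ∀ μ, f μ ∈ powers x := by
  classical
  have htop := iSup_eigenspace_eq_top B hB.symm hB.pos (LinearMap.mulLeft ℝ x)
    (fun u v => hB.assoc x u v)
  -- The idempotents of `x` are the components of the unit along the eigenspaces of L(x).
  obtain ⟨f, hf, hsum⟩ := (Submodule.mem_iSup_iff_exists_finsupp _ (1 : A)).1
    (htop ▸ Submodule.mem_top)
  have hev : ∀ p : ℝ[X], evalAt x p = ∑ μ : f.support, p.eval (μ : ℝ) • f μ := fun p => by
    rw [evalAt_apply, ← hsum, Finsupp.sum, map_sum, ← Finset.sum_coe_sort]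
    exact Finset.sum_congr rfl fun μ _ => Module.End.aeval_apply_of_hasEigenvector
      ⟨hf μ, Finsupp.mem_support_iff.1 μ.2⟩
  have hbasis : ∀ μ : f.support,
      f μ = evalAt x (Lagrange.basis Finset.univ ((↑) : f.support → ℝ) μ) := fun μ => by
    rw [hev, Finset.sum_eq_single μ]
    · rw [Lagrange.eval_basis_self Subtype.val_injective.injOn (Finset.mem_univ μ), one_smul]
    · intro j _ hj
      rw [Lagrange.eval_basis_of_ne hj.symm (Finset.mem_univ j), zero_smul]
    · simp
  have hmul : ∀ (p : ℝ[X]) (μ : f.support), evalAt x p * f μ = p.eval (μ : ℝ) • f μ :=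
      fun p μ => by
    rw [hbasis, evalAt_mul, mul_comm, evalAt_apply, map_mul, Module.End.mul_apply, ← evalAt_apply,
      ← hbasis]
    exact Module.End.aeval_apply_of_hasEigenvector ⟨hf μ, Finsupp.mem_support_iff.1 μ.2⟩
  refine ⟨f.support, fun μ => f μ, ⟨fun μ => ?_, fun μ => Finsupp.mem_support_iff.1 μ.2,
    fun μ ν h => ?_, (Finset.sum_coe_sort f.support f).trans hsum⟩, ?_,
    fun μ => ?_⟩
  · nth_rw 1 [hbasis μ]
    rw [hmul, Lagrange.eval_basis_self Subtype.val_injective.injOn (Finset.mem_univ μ), one_smul]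
  · rw [hbasis μ, hmul, Lagrange.eval_basis_of_ne h (Finset.mem_univ ν), zero_smul]
  · simpa [evalAt_apply] using hev X
  · change f μ ∈ _
    rw [hbasis μ]
    exact evalAt_mem_powers x _

end Spectral

section Frames

variable {A : Type*} [NonAssocCommRing A] [Module ℝ A]

theorem mul_eq_zero_of_add_idem {a b : A} (ha : a * a = a) (hb : b * b = b)
    (hab : (a + b) * (a + b) = a + b) : a * b = 0 := by
  rw [add_mul, mul_add, mul_add, ha, hb, mul_comm b a] at hab
  have h : (2 : ℝ) • (a * b) = 0 := by linear_combination (norm := module) hab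
  exact (smul_eq_zero_iff_right (by norm_num)).1 h

variable [IsCommJordan A]

/-- An orthogonal system with a non-primitive member can be refined. -/
theorem IsCompleteSystem.refine {ι : Type*} [Fintype ι] [DecidableEq ι] {d : ι → A}
    (hd : IsCompleteSystem d) {i : ι} {a b : A} (ha : a * a = a) (hb : b * b = b) (ha0 : a ≠ 0)
    (hb0 : b ≠ 0) (hab : a + b = d i) :
    IsCompleteSystem (fun o : Option ι => o.elim b (Function.update d i a)) := by
  have hab0 : a * b = 0 := mul_eq_zero_of_add_idem ha hb (hab ▸ hd.idem i)
  have hda : d i * a = a := by rw [← hab, add_mul, ha, mul_comm b, hab0, add_zero]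
  have hdb : d i * b = b := by rw [← hab, add_mul, hb, hab0, zero_add]
  have hja : ∀ j, j ≠ i → d j * a = 0 := fun j hj =>
    mul_eq_zero_of_peirce (hd.idem i) (hd.orthogonal i j hj.symm) hda
  have hjb : ∀ j, j ≠ i → d j * b = 0 := fun j hj =>
    mul_eq_zero_of_peirce (hd.idem i) (hd.orthogonal i j hj.symm) hdb
  have hub : ∀ j, Function.update d i a j * b = 0 := fun j => by
    rcases eq_or_ne j i with rfl | hj
    · simpa using hab0
    · simpa [hj] using hjb j hj
  refine ⟨?_, ?_, ?_, ?_⟩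
  · rintro (_ | j)
    · exact hb
    · rcases eq_or_ne j i with rfl | hj
      · simpa using ha
      · simpa [hj] using hd.idem j
  · rintro (_ | j)
    · exact hb0
    · rcases eq_or_ne j i with rfl | hj
      · simpa using ha0
      · simpa [hj] using hd.ne_zero j
  · rintro (_ | j) (_ | k) hjk
    · exact absurd rfl hjk
    · exact (mul_comm _ _).trans (hub k)
    · exact hub j
    · have hjk : j ≠ k := fun h => hjk (h ▸ rfl)
      rcases eq_or_ne j i with rfl | hj
      · simpa [hjk.symm, mul_comm a] using hja k hjk.symm
      · rcases eq_or_ne k i with rfl | hk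
        · simpa [hj] using hja j hj
        · simpa [hj, hk] using hd.orthogonal j k hjk
  · rw [Fintype.sum_option, ← hd.complete, ← Finset.add_sum_erase _ _ (Finset.mem_univ i),
      ← Finset.add_sum_erase _ d (Finset.mem_univ i), ← hab]
    have : ∀ j ∈ Finset.univ.erase i, Function.update d i a j = d j := fun j hj => by
      simp [Finset.ne_of_mem_erase hj]
    simp only [Option.elim, Function.update_self, Finset.sum_congr rfl this]
    abel

variable [SMulCommClass ℝ A A] [Module.Finite ℝ A]

/-- Split non-primitive members, both halves keeping the old coefficient. Linear independence bounds
the size of a system by the dimension, so `m` serves as fuel. -/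
theorem IsCompleteSystem.exists_frame (m : ℕ) : ∀ {ι : Type} [Fintype ι] {d : ι → A}
    (_ : IsCompleteSystem d) (l : ι → ℝ) (_ : Module.finrank ℝ A < Fintype.card ι + m),
    ∃ (r : ℕ) (c : Fin r → A) (k : Fin r → ℝ), IsJordanFrame c ∧
      ∑ i, l i • d i = ∑ i, k i • c i := by
  classical
  induction m with
  | zero =>
    intro ι _ d hd l h
    exact absurd hd.linearIndependent.fintype_card_le_finrank (by omega)
  | succ m ih =>
    intro ι _ d hd l h
    by_cases hp : ∀ i, IsPrimitiveIdempotent (d i)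
    · let e := (Fintype.equivFin ι).symm
      refine ⟨_, d ∘ e, l ∘ e, ⟨fun i => hp _, fun i j hij => hd.orthogonal _ _
        (e.injective.ne hij), ?_⟩, ?_⟩
      · exact (Equiv.sum_comp e d).trans hd.complete
      · exact (Equiv.sum_comp e fun i => l i • d i).symm
    · push Not at hp
      obtain ⟨i, hi⟩ := hp
      have : ∃ a b : A, a * a = a ∧ b * b = b ∧ a + b = d i ∧ a ≠ 0 ∧ b ≠ 0 := by
        by_contra hcon
        push Not at hcon
        refine hi ⟨hd.idem i, hd.ne_zero i, fun a b ha hb hab => ?_⟩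
        by_contra hne
        push Not at hne
        exact hne.2 (hcon a b ha hb hab hne.1)
      obtain ⟨a, b, ha, hb, hab, ha0, hb0⟩ := this
      obtain ⟨r, c, k, hc, hk⟩ := ih (hd.refine ha hb ha0 hb0 hab)
        (fun o => o.elim (l i) l) (by rw [Fintype.card_option]; omega)
      refine ⟨r, c, k, hc, ?_⟩
      rw [← hk, Fintype.sum_option, ← Finset.add_sum_erase _ (fun j => (some j).elim (l i) l •
        (some j).elim b (Function.update d i a)) (Finset.mem_univ i), ← Finset.add_sum_erase _ (fun j => l j • d j) (Finset.mem_univ i), ← hab]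
      have : ∀ j ∈ Finset.univ.erase i, l j • Function.update d i a j = l j • d j :=
        fun j hj => by simp [Finset.ne_of_mem_erase hj]
      simp only [Option.elim, Function.update_self, Finset.sum_congr rfl this, smul_add]
      abel

variable [IsScalarTower ℝ A A] {B : A →ₗ[ℝ] A →ₗ[ℝ] ℝ}

/-- The spectral theorem. -/
theorem IsAssociativeInner.exists_frame (hB : IsAssociativeInner B) (x : A) :
    ∃ (r : ℕ) (c : Fin r → A) (k : Fin r → ℝ), IsJordanFrame c ∧ x = ∑ i, k i • c i := by
  obtain ⟨S, f, hf, hx, -⟩ := hB.exists_spectral x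
  obtain ⟨r, c, k, hc, hk⟩ := hf.exists_frame (Module.finrank ℝ A + 1) (fun μ => (μ : ℝ)) (by omega)
  exact ⟨r, c, k, hc, hx.trans hk⟩

theorem IsAssociativeInner.hasEigenvalues_eigenvalues (hB : IsAssociativeInner B) (x : A) :
    HasEigenvalues x (eigenvalues x) := by
  obtain ⟨r, c, k, hc, hk⟩ := hB.exists_frame x
  have h : ∃ s, HasEigenvalues x s := ⟨_, r, c, k, hc, hk, rfl⟩
  rw [eigenvalues, dif_pos h]
  exact h.choose_spec

/-- The Peirce space `A_1` of a primitive idempotent is one-dimensional. -/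
theorem IsAssociativeInner.exists_eq_smul (hB : IsAssociativeInner B) {c x : A}
    (hc : IsPrimitiveIdempotent c) (hx : c * x = x) : ∃ a : ℝ, x = a • c := by
  have hcc : c * c = c := hc.idem
  obtain ⟨S, f, hf, hxf, hfp⟩ := hB.exists_spectral x
  -- A_1(c) contains x ℝ[x], hence every `f μ` with μ ≠ 0; primitivity then forces `f μ = c`.
  have hpow : ∀ k, c * (x * pow x k) = x * pow x k := fun k => by
    induction k with
    | zero => simpa [pow] using hx
    | succ k ih => exact mul_mul_eq_self hcc hx ih
  have hpowers : ∀ u ∈ powers x, c * (x * u) = x * u := fun u hu => by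
    induction hu using Submodule.span_induction with
    | mem u hu => obtain ⟨k, rfl⟩ := hu; exact hpow k
    | zero => simp
    | add u v _ _ hu hv => simp only [mul_add, hu, hv]
    | smul a u _ hu => simp only [mul_smul_comm, hu]
  have hxm : ∀ μ : S, x * f μ = (μ : ℝ) • f μ := fun μ => by
    rw [mul_comm]; nth_rw 1 [hxf]; exact hf.mul_sum_smul _ μ
  have h1 : ∀ μ : S, (μ : ℝ) ≠ 0 → c * f μ = f μ := fun μ hμ => by
    have h := hpowers _ (hfp μ)
    rw [hxm, mul_smul_comm] at h
    exact smul_right_injective A hμ h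
  have h2 : ∀ μ : S, (μ : ℝ) ≠ 0 → f μ = c := fun μ hμ => by
    have h := hc.primitive (f μ) (c - f μ) (hf.idem μ) (by
      simp only [IsIdempotentElem, sub_mul, mul_sub, hcc, h1 μ hμ, mul_comm (f μ) c, hf.idem]
      abel) (by abel)
    exact (sub_eq_zero.1 (h.resolve_left (hf.ne_zero μ))).symm
  by_cases hex : ∃ μ : S, (μ : ℝ) ≠ 0
  · obtain ⟨μ, hμ⟩ := hex
    refine ⟨μ, ?_⟩
    rw [← h2 μ hμ, ← hxm, h2 μ hμ, mul_comm, hx]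
  · push Not at hex
    refine ⟨0, ?_⟩
    rw [hxf, zero_smul]
    exact Finset.sum_eq_zero fun μ _ => by rw [hex μ, zero_smul]

end Frames

/-- In a simple algebra an idempotent without Peirce space `A_{1/2}` is trivial. -/
theorem eq_zero_or_eq_one_of_isSimpleRing {A : Type*} [NonAssocCommRing A] [Module ℝ A]
    [IsCommJordan A] [IsSimpleRing A] {p : A} (hp : p * p = p) (h : ∀ x, p * (p * x) = p * x) :
    p = 0 ∨ p = 1 := by
  -- Without A_{1/2}, the space A_1(p) is an ideal: the A_0-part of `x` annihilates `y`.
  have hmul : ∀ {x y : A}, p * y = y → p * (x * y) = x * y := fun {x y} hy => by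
    have h1 : p * (x - p * x) = 0 := by rw [mul_sub, h, sub_self]
    have h2 : x * y = (p * x) * y := by
      rw [← sub_eq_zero, ← sub_mul, mul_eq_zero_of_peirce hp h1 hy]
    rw [h2, mul_mul_eq_self hp (h x) hy]
  let I : TwoSidedIdeal A := TwoSidedIdeal.mk' {x | p * x = x} (mul_zero p)
    (fun {x y} (hx : p * x = x) (hy : p * y = y) => show p * (x + y) = x + y by
      rw [mul_add, hx, hy])
    (fun {x} (hx : p * x = x) => show p * (-x) = -x by rw [mul_neg, hx])
    hmul (fun {x y} hx => by rw [mul_comm x y]; exact hmul hx)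
  have hI : ∀ x, x ∈ I ↔ p * x = x := fun x => by
    simp only [I, TwoSidedIdeal.mem_mk', Set.mem_ofPred_eq]
  rcases eq_bot_or_eq_top I with hbot | htop
  · left
    have := (hI p).2 hp
    rwa [hbot, TwoSidedIdeal.mem_bot] at this
  · right
    have := (hI 1).1 (htop ▸ TwoSidedIdeal.mem_top A)
    rwa [mul_one] at this

/-! ### Equal weights along a frame of a simple algebra -/

section OffDiagonal

variable {A : Type*} [NonAssocCommRing A] [Module ℝ A] [SMulCommClass ℝ A A]
  [IsScalarTower ℝ A A] [IsCommJordan A] [Module.Finite ℝ A] {B : A →ₗ[ℝ] A →ₗ[ℝ] ℝ}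

/-- One-dimensionality of A_1(c) and A_1(c') gives x² = a c + b c'. Comparing the c-components of
x²x² and x(x x²) gives a² = a(a + b)/2, and a ≠ 0 by positivity of `B`, so a = b. -/
theorem IsAssociativeInner.exists_sq_eq (hB : IsAssociativeInner B) {c c' x : A}
    (hc : IsPrimitiveIdempotent c) (hc' : IsPrimitiveIdempotent c') (hcc' : c * c' = 0)
    (hx : c * x = (1 / 2 : ℝ) • x) (hx' : c' * x = (1 / 2 : ℝ) • x) (hx0 : x ≠ 0) :
    ∃ a : ℝ, x * x = a • (c + c') ∧ a * B c 1 = B x x / 2 ∧ a * B c' 1 = B x x / 2 := by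
  have h1 : c * c = c := hc.idem
  have h1' : c' * c' = c' := hc'.idem
  have hs : (c + c') * x = x := by rw [add_mul, hx, hx']; module
  have hss : (c + c') * (x * x) = x * x := mul_mul_eq_self
    (by simp [add_mul, mul_add, h1, h1', hcc', mul_comm c' c]) hs hs
  obtain ⟨a, ha⟩ := hB.exists_eq_smul hc (mul_mul_sq_of_half h1 hx)
  obtain ⟨b, hb⟩ := hB.exists_eq_smul hc' (mul_mul_sq_of_half h1' hx')
  have hxx : x * x = a • c + b • c' := by rw [← ha, ← hb, ← add_mul, hss]
  have hBx : ∀ e : A, e * e = e → e * x = (1 / 2 : ℝ) • x → B (e * (x * x)) 1 = B x x / 2 :=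
      fun e he hex => by
    rw [hB.assoc, mul_one, hB.assoc, mul_comm x e, hex, map_smul, smul_eq_mul]
    ring
  have hBa : a * B c 1 = B x x / 2 := by
    rw [← hBx c h1 hx, ha, map_smul, LinearMap.smul_apply, smul_eq_mul]
  have hBb : b * B c' 1 = B x x / 2 := by
    rw [← hBx c' h1' hx', hb, map_smul, LinearMap.smul_apply, smul_eq_mul]
  have hpos := hB.pos x hx0
  have ha0 : a ≠ 0 := fun h => by rw [h, zero_mul] at hBa; linarith
  have hxxx : x * (x * x) = ((a + b) / 2) • x := by
    rw [hxx, mul_add, mul_smul_comm, mul_smul_comm, mul_comm x c, mul_comm x c', hx, hx']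
    module
  have hp : (x * x) * (x * x) = x * (x * (x * x)) := by
    have h := commute_mulLeft_pow x 2 x
    simp only [pow, mul_one] at h
    rw [← h, mul_comm (x * x) x]
  rw [hxxx, mul_smul_comm] at hp
  have hq := congrArg (c * ·) hp
  have hcx : c * (x * x) = a • c := ha
  have hcxx : c * ((x * x) * (x * x)) = (a * a) • c := by
    rw [hxx]
    simp only [mul_add, add_mul, mul_smul_comm, smul_mul_assoc, h1, h1', hcc', mul_comm c' c,
      smul_zero, add_zero, zero_add, smul_smul]
  rw [hcxx] at hq
  simp only [mul_smul_comm, hcx, smul_smul] at hq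
  have hab : a * a = (a + b) / 2 * a := by
    by_contra h
    exact hc.ne_zero ((smul_eq_zero.1 (by rw [sub_smul, hq, sub_self] :
      (a * a - (a + b) / 2 * a) • c = 0)).resolve_left (sub_ne_zero.2 h))
  have hab' : b = a := by
    have := mul_right_cancel₀ ha0 hab
    linarith
  rw [hab'] at hBb hxx
  exact ⟨a, by rw [hxx, smul_add], hBa, hBb⟩

variable [IsSimpleRing A]

/-- Idempotents of different weight have zero mixed Peirce space. The sum `p` of those with the
weight of `c i` would then have no A_{1/2}, so p = 0 or p = 1, although it contains `c i` and omits
`c j`. -/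
theorem IsAssociativeInner.apply_one_eq (hB : IsAssociativeInner B) {r : ℕ} {c : Fin r → A}
    (hc : IsJordanFrame c) (i j : Fin r) : B (c i) 1 = B (c j) 1 := by
  classical
  by_contra hij
  have hcs := hc.isCompleteSystem
  have hzero : ∀ k m, B (c k) 1 ≠ B (c m) 1 → ∀ x, c k * (c m * x) = 0 := fun k m hkm x => by
    have hne : k ≠ m := fun h => hkm (h ▸ rfl)
    by_contra h0
    have hcomm := mul_left_comm_of_mul_eq_zero (hcs.idem k) (hc.orthogonal k m hne) x
    obtain ⟨a, -, h1, h2⟩ := hB.exists_sq_eq (hc.primitive k) (hc.primitive m)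
      (hc.orthogonal k m hne)
      (mul_mul_mul_of_orthogonal (hcs.idem k) (hc.orthogonal k m hne) x)
      (hcomm ▸ mul_mul_mul_of_orthogonal (hcs.idem m) (hc.orthogonal m k hne.symm) x) h0
    have hpos := hB.pos _ h0
    have ha0 : a ≠ 0 := fun h => by rw [h, zero_mul] at h1; linarith
    exact hkm (mul_left_cancel₀ ha0 (h1.trans h2.symm))
  let l : Fin r → ℝ := fun k => if B (c k) 1 = B (c i) 1 then 1 else 0
  set p := ∑ k, l k • c k with hpdef
  have hq : (1 : A) - p = ∑ k, (1 - l k) • c k := by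
    simp only [sub_smul, one_smul, Finset.sum_sub_distrib, hc.complete, hpdef]
  have hpp : p * p = p := by
    rw [hpdef, hcs.sum_smul_mul_sum_smul]
    refine Finset.sum_congr rfl fun k _ => ?_
    simp only [l]
    split_ifs <;> simp
  have hpq : ∀ x, p * ((1 - p) * x) = 0 := fun x => by
    rw [hq, hpdef, Finset.sum_mul]
    refine Finset.sum_eq_zero fun k _ => ?_
    rw [Finset.sum_mul, Finset.mul_sum]
    refine Finset.sum_eq_zero fun m _ => ?_
    rw [smul_mul_assoc, smul_mul_assoc, mul_smul_comm]
    by_cases hk : B (c k) 1 = B (c i) 1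
    · by_cases hm : B (c m) 1 = B (c i) 1
      · simp [l, hm]
      · rw [hzero k m (fun h => hm (h ▸ hk))]; simp
    · simp [l, hk]
  have hpi : c i * p = c i := by rw [hpdef, hcs.mul_sum_smul]; simp [l]
  have hpj : c j * p = 0 := by rw [hpdef, hcs.mul_sum_smul]; simp [l, Ne.symm hij]
  rcases eq_zero_or_eq_one_of_isSimpleRing hpp (fun x => by
    have := hpq x
    rw [sub_mul, one_mul, mul_sub, sub_eq_zero] at this
    exact this.symm) with h | h
  · rw [h, mul_zero] at hpi
    exact hcs.ne_zero i hpi.symm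
  · rw [h, mul_one] at hpj
    exact hcs.ne_zero j hpj

end OffDiagonal

/-! ### The inner product on Peirce components -/

section Inner

variable {A : Type*} [NonAssocCommRing A] [Module ℝ A] {B : A →ₗ[ℝ] A →ₗ[ℝ] ℝ}

theorem IsAssociativeInner.mul_apply_one (hB : IsAssociativeInner B) (x y : A) :
    B (x * y) 1 = B x y := by
  rw [hB.assoc, mul_one, hB.symm]

theorem IsAssociativeInner.apply_eq_zero (hB : IsAssociativeInner B) {c u v : A} {a b : ℝ}
    (hu : c * u = a • u) (hv : c * v = b • v) (hab : a ≠ b) : B u v = 0 := by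
  have h := hB.assoc c u v
  rw [hu, hv, map_smul, LinearMap.smul_apply, map_smul, smul_eq_mul, smul_eq_mul] at h
  have h' : (a - b) * B u v = 0 := by linear_combination h
  exact (mul_eq_zero.1 h').resolve_left (sub_ne_zero.2 hab)

theorem IsAssociativeInner.apply_half_one (hB : IsAssociativeInner B) {c ξ : A}
    (hc : c * c = c) (hξ : c * ξ = (1 / 2 : ℝ) • ξ) : B ξ 1 = 0 := by
  have h1 : B c ξ = 0 := hB.apply_eq_zero (a := 1) (by rw [hc, one_smul]) hξ (by norm_num)
  have h2 : B (c * 1) ξ = B 1 (c * ξ) := hB.assoc ..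
  rw [mul_one, h1, hξ, map_smul, smul_eq_mul] at h2
  rw [hB.symm]
  linarith

theorem IsAssociativeInner.peirce_sq (hB : IsAssociativeInner B) {c z ξ : A}
    (hc : c * c = c) (hz : c * z = 0) (hξ : c * ξ = (1 / 2 : ℝ) • ξ) (hc1 : B c 1 = 1) (t : ℝ) :
    B (z + ξ + t • c) (z + ξ + t • c) = B z z + B ξ ξ + t ^ 2 := by
  have hz' : c * z = (0 : ℝ) • z := by rw [hz, zero_smul]
  have hc' : c * c = (1 : ℝ) • c := by rw [hc, one_smul]
  have hcc : B c c = 1 := by rw [← hB.mul_apply_one, hc, hc1]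
  have h1 : B z ξ = 0 := hB.apply_eq_zero hz' hξ (by norm_num)
  have h2 : B c ξ = 0 := hB.apply_eq_zero hc' hξ (by norm_num)
  have h3 : B c z = 0 := hB.apply_eq_zero hc' hz' (by norm_num)
  have h1' := hB.symm ξ z
  have h2' := hB.symm ξ c
  have h3' := hB.symm z c
  simp only [map_add, map_smul, LinearMap.add_apply, LinearMap.smul_apply, smul_eq_mul]
  rw [h1', h2', h3', h1, h2, h3, hcc]
  ring

variable [IsCommJordan A]

/-- Multiplication by an idempotent is positive semidefinite. -/
theorem IsAssociativeInner.mul_apply_nonneg (hB : IsAssociativeInner B) {e : A} (he : e * e = e)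
    (x : A) : 0 ≤ B (e * x) x := by
  have hnn : ∀ v, 0 ≤ B v v := fun v => by
    rcases eq_or_ne v 0 with rfl | h
    · simp
    · exact (hB.pos v h).le
  have h3 : B (e * (e * (e * x))) x = B (e * (e * x)) (e * x) := hB.assoc ..
  have h2 : B (e * (e * x)) x = B (e * x) (e * x) := hB.assoc ..
  have h4 : B (e * x) (e * (e * x)) = B (e * (e * x)) (e * x) := hB.symm ..
  have hp := congrArg (fun u => B u x) (peirce_polynomial he x)
  have hp' := congrArg (fun u => B u (e * x)) (peirce_polynomial he x)
  have h5 : B (e * (e * (e * x))) (e * x) = B (e * (e * x)) (e * (e * x)) := hB.assoc ..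
  have h6 := hnn (e * x)
  -- With w = ex - e(ex), the Peirce polynomial gives B(ex,x) = B(ex,ex) + 4B(w,w).
  have h7 := hnn (e * x - e * (e * x))
  simp only [map_add, map_sub, map_smul, LinearMap.add_apply, LinearMap.sub_apply,
    LinearMap.smul_apply, smul_eq_mul] at hp hp' h7
  nlinarith

/-- Each B(e_i,d) = B(e_i d,d) is nonnegative, and together they sum to B(d,d) > 0. -/
theorem IsAssociativeInner.apply_idem_pos (hB : IsAssociativeInner B) {ι : Type*} [Fintype ι]
    {e : ι → A} (he : IsCompleteSystem e) {l : ι → ℝ} (hl : ∀ i, 0 < l i) {d : A}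
    (hd : d * d = d) (hd0 : d ≠ 0) : 0 < B (∑ i, l i • e i) d := by
  have hnn : ∀ i, 0 ≤ B (e i) d := fun i => by
    have h := hB.mul_apply_nonneg (he.idem i) d
    rwa [hB.assoc, mul_comm, hB.symm, hB.assoc, hd] at h
  have hsum : 0 < ∑ i, B (e i) d := by
    have h : B (∑ i, e i) d = B d d := by
      rw [he.complete, ← hd, hB.symm, hB.mul_apply_one, hd]
    rw [map_sum, LinearMap.sum_apply] at h
    exact h ▸ hB.pos d hd0
  obtain ⟨i, -, hi⟩ := Finset.exists_lt_of_sum_lt (s := Finset.univ) (f := fun _ : ι => (0 : ℝ))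
    (g := fun i => B (e i) d) (by simpa using hsum)
  rw [map_sum, LinearMap.sum_apply]
  refine Finset.sum_pos' (fun j _ => ?_) ⟨i, Finset.mem_univ i, ?_⟩
  · rw [map_smul, LinearMap.smul_apply, smul_eq_mul]
    exact mul_nonneg (hl j).le (hnn j)
  · rw [map_smul, LinearMap.smul_apply, smul_eq_mul]
    exact mul_pos (hl i) hi

variable [SMulCommClass ℝ A A] [IsScalarTower ℝ A A]

theorem IsAssociativeInner.peirce_cube (hB : IsAssociativeInner B) {c z ξ : A}
    (hc : c * c = c) (hz : c * z = 0) (hξ : c * ξ = (1 / 2 : ℝ) • ξ) (hc1 : B c 1 = 1) (t : ℝ) :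
    B (z + ξ + t • c) ((z + ξ + t • c) * (z + ξ + t • c)) =
      B z (z * z) + t ^ 3 + 3 * B (z * ξ) ξ + 3 / 2 * t * B ξ ξ := by
  have hz' : c * z = (0 : ℝ) • z := by rw [hz, zero_smul]
  have hzz : c * (z * z) = (0 : ℝ) • (z * z) := by rw [mul_mul_eq_zero hc hz hz, zero_smul]
  have hc' : c * c = (1 : ℝ) • c := by rw [hc, one_smul]
  have hcc : B c c = 1 := by rw [← hB.mul_apply_one, hc, hc1]
  have h1 : B z ξ = 0 := hB.apply_eq_zero hz' hξ (by norm_num)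
  have h2 : B c ξ = 0 := hB.apply_eq_zero hc' hξ (by norm_num)
  have h3 : B c z = 0 := hB.apply_eq_zero hc' hz' (by norm_num)
  have h4 : B (z * z) ξ = 0 := hB.apply_eq_zero hzz hξ (by norm_num)
  have h5 : B c (z * z) = 0 := hB.apply_eq_zero hc' hzz (by norm_num)
  -- cξ² lies in A_1, so it is orthogonal to ξ; moving `c` across shows B(ξ,ξ²) = 2B(ξ,cξ²).
  have h6 : B ξ (ξ * ξ) = 0 := by
    have e1 : B (c * ξ) (ξ * ξ) = B ξ (c * (ξ * ξ)) := hB.assoc ..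
    have e2 : B (c * ξ) (c * (ξ * ξ)) = B ξ (c * (c * (ξ * ξ))) := hB.assoc ..
    rw [mul_mul_sq_of_half hc hξ] at e2
    rw [hξ, map_smul, LinearMap.smul_apply, smul_eq_mul] at e1 e2
    linarith
  have h7 : B z (ξ * ξ) = B (z * ξ) ξ := by rw [← hB.assoc, mul_comm]
  have h8 : B z (z * ξ) = 0 := by rw [← hB.assoc, h4]
  have h9 : B ξ (z * ξ) = B (z * ξ) ξ := hB.symm ..
  have h10 : B c (ξ * ξ) = 1 / 2 * B ξ ξ := by
    rw [← hB.assoc, mul_comm, hξ, map_smul, LinearMap.smul_apply, smul_eq_mul]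
  have h11 : B c (z * ξ) = 0 := by rw [← hB.assoc, mul_comm, hz, map_zero, LinearMap.zero_apply]
  have hyy : (z + ξ + t • c) * (z + ξ + t • c) =
      z * z + ξ * ξ + t ^ 2 • c + (2 : ℝ) • (z * ξ) + t • ξ := by
    simp only [mul_add, add_mul, mul_smul_comm, smul_mul_assoc, hc, hz, hξ, mul_comm z c,
      mul_comm ξ c, mul_comm ξ z]
    module
  rw [hyy]
  have h2' := hB.symm ξ c
  have h3' := hB.symm z c
  have h4' := hB.symm ξ (z * z)
  simp only [map_add, map_smul, LinearMap.add_apply, LinearMap.smul_apply, smul_eq_mul]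
  rw [h2', h3', h4', h1, h2, h3, h4, h5, h6, h7, h8, h9, h10, h11, hcc]
  ring

end Inner

theorem sum_apply_one {A : Type*} [NonAssocCommRing A] [Module ℝ A] {B : A →ₗ[ℝ] A →ₗ[ℝ] ℝ}
    {r : ℕ} {c : Fin r → A} (h : ∀ i, B (c i) 1 = 1) (l : Fin r → ℝ) :
    B (∑ i, l i • c i) 1 = ∑ i, l i := by
  simp only [map_sum, LinearMap.sum_apply, map_smul, LinearMap.smul_apply, smul_eq_mul, h, mul_one]

/-! ### Length of Jordan frames and normalization -/

section Rank

variable {A : Type*} [NonAssocCommRing A] [Module ℝ A] [SMulCommClass ℝ A A]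
  [IsScalarTower ℝ A A] [IsCommJordan A] [Module.Finite ℝ A] [IsSimpleRing A]
  {B : A →ₗ[ℝ] A →ₗ[ℝ] ℝ}

theorem IsAssociativeInner.length_mul_apply_one (hB : IsAssociativeInner B) {r : ℕ}
    {c : Fin r → A} (hc : IsJordanFrame c) (i : Fin r) : r * B (c i) 1 = B 1 1 := by
  have h : B (∑ j, c j) 1 = B 1 1 := by rw [hc.complete]
  rw [map_sum, LinearMap.sum_apply, Finset.sum_congr rfl fun j _ => hB.apply_one_eq hc j i] at h
  simpa using h

/-- A simple algebra with Jordan frames of length `2` has none of length `3`. -/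
theorem IsAssociativeInner.not_frame_two_three (hB : IsAssociativeInner B) {d : Fin 2 → A}
    (hd : IsJordanFrame d) {c : Fin 3 → A} (hc : IsJordanFrame c) : False := by
  have hds := hd.isCompleteSystem
  have hd0 := hB.length_mul_apply_one hd 0
  have hd1 := hB.length_mul_apply_one hd 1
  have hx1 := hB.length_mul_apply_one hc 0
  have hxx : c 0 * c 0 = c 0 := hc.isCompleteSystem.idem 0
  generalize c 0 = x at hx1 hxx
  have hone : B 1 1 ≠ 0 := by
    refine (hB.pos 1 fun h => hds.ne_zero 0 ?_).ne'
    rw [← mul_one (d 0), h, mul_zero]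
  push_cast at hd0 hd1 hx1
  have hp : d 0 * d 0 = d 0 := hds.idem 0
  have hsum : d 0 + d 1 = 1 := by simpa [Fin.sum_univ_two] using hds.complete
  have h01 : d 0 * d 1 = 0 := hds.orthogonal 0 1 (by decide)
  have hpoly := peirce_polynomial hp x
  -- Peirce components of `x` for `d 0`: the projections are 2L² - L, 1 - 3L + 2L² and 4(L - L²).
  obtain ⟨a, ha⟩ := hB.exists_eq_smul (hd.primitive 0) (mul_mul_mul_of_orthogonal_aux hp x)
  have hx0 : d 0 * (x - (3 : ℝ) • (d 0 * x) + (2 : ℝ) • (d 0 * (d 0 * x))) = 0 := by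
    simp only [mul_add, mul_sub, mul_smul_comm]
    linear_combination (norm := module) hpoly
  obtain ⟨b, hb⟩ := hB.exists_eq_smul (hd.primitive 1) (x := x - (3 : ℝ) • (d 0 * x) +
    (2 : ℝ) • (d 0 * (d 0 * x))) (by
      rw [← eq_sub_iff_add_eq'.2 hsum |>.symm, sub_mul, hx0, one_mul, sub_zero])
  obtain ⟨ξ, hξ⟩ : ∃ ξ, ξ = (4 : ℝ) • (d 0 * x - d 0 * (d 0 * x)) := ⟨_, rfl⟩
  have hxd : x = a • d 0 + b • d 1 + ξ := by rw [← ha, ← hb, hξ]; module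
  have hξ0 : d 0 * ξ = (1 / 2 : ℝ) • ξ := by
    rw [hξ, mul_smul_comm, mul_sub]
    linear_combination (norm := module) (-2 : ℝ) • hpoly
  have hξ1 : d 1 * ξ = (1 / 2 : ℝ) • ξ := by
    rw [← sub_eq_of_eq_add' hsum.symm, sub_mul, one_mul, hξ0]
    module
  have hBξ := hB.apply_half_one hp hξ0
  have hBx : B x 1 = a * B (d 0) 1 + b * B (d 1) 1 := by
    rw [hxd]
    simp only [map_add, map_smul, LinearMap.add_apply, LinearMap.smul_apply, smul_eq_mul, hBξ,
      add_zero]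
  -- `x` has weight B(1,1)/3, while `d 0` and `d 1` have weight B(1,1)/2.
  have hs : a + b = 2 / 3 := by
    refine mul_right_cancel₀ hone ?_
    linear_combination -2 * hBx + 2 / 3 * hx1 - a * hd0 - b * hd1
  -- If ξ = 0, then a and b are 0 or 1 and cannot sum to 2/3. Otherwise B(x²,ξ) = B(x,xξ) reads
  -- B(ξ,ξ) = (1/3 + 1/3)B(ξ,ξ).
  rcases eq_or_ne ξ 0 with h0 | h0
  · have hab : x = ∑ i, ![a, b] i • d i := by simp [Fin.sum_univ_two, hxd, h0]
    have hval : ∀ i, ![a, b] i * ![a, b] i = ![a, b] i := fun i => by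
      have h1 := hds.mul_sum_smul (![a, b]) i
      have h2 := hds.mul_sum_smul (fun i => ![a, b] i * ![a, b] i) i
      rw [← hds.sum_smul_mul_sum_smul, ← hab, hxx, hab, h1] at h2
      by_contra h
      exact hds.ne_zero i ((smul_eq_zero.1 (by rw [sub_smul, ← h2, sub_self] :
        (![a, b] i * ![a, b] i - ![a, b] i) • d i = 0)).resolve_left (sub_ne_zero.2 h))
    have ha := hval 0
    have hb := hval 1
    simp only [Matrix.cons_val_zero, Matrix.cons_val_one] at ha hb
    nlinarith
  · obtain ⟨g, hg, hg0, -⟩ := hB.exists_sq_eq (hd.primitive 0) (hd.primitive 1) h01 hξ0 hξ1 h0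
    have hxξ : x * ξ = ((a + b) / 2) • ξ + g • 1 := by
      rw [hxd, add_mul, add_mul, smul_mul_assoc, smul_mul_assoc, hξ0, hξ1, hg, hsum]
      module
    have hd0ξ : B (d 0) ξ = 0 := hB.apply_eq_zero (a := 1) (by rw [hp, one_smul]) hξ0 (by norm_num)
    have hd1ξ : B (d 1) ξ = 0 := hB.apply_eq_zero (a := 0) (by rw [h01, zero_smul]) hξ0
      (by norm_num)
    have hBxξ : B x ξ = B ξ ξ := by
      rw [hxd]
      simp only [map_add, map_smul, LinearMap.add_apply, LinearMap.smul_apply, smul_eq_mul, hd0ξ,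
        hd1ξ, mul_zero, zero_add]
    have h := hB.assoc x x ξ
    rw [hxx, hxξ, map_add, map_smul, map_smul, smul_eq_mul, smul_eq_mul, hBxξ, hs] at h
    have hpos := hB.pos ξ h0
    have : g * B x 1 = 1 / 3 * B ξ ξ := by
      linear_combination (g / 3) * (hx1 - hd0) + 2 / 3 * hg0
    linarith

/-- The rank bounds the length by 3. Length 0 makes the algebra trivial, length 1 makes the unit
primitive, and length 2 conflicts with `c`. -/
theorem IsAssociativeInner.frame_length (hB : IsAssociativeInner B) (hr : HasRank A 3)
    {c : Fin 3 → A} (hc : IsJordanFrame c) {r : ℕ} {d : Fin r → A} (hd : IsJordanFrame d) :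
    r = 3 := by
  have hle : r ≤ 3 := by
    have h := hd.isCompleteSystem.card_le_degree (l := fun i => ((i : ℕ) : ℝ))
      (Nat.cast_injective.comp Fin.val_injective)
    rw [Fintype.card_fin] at h
    exact h.trans (hr.2 ⟨_, rfl⟩)
  have hcs := hc.isCompleteSystem
  interval_cases r
  · have h : (1 : A) = 0 := by rw [← hd.complete, Fin.sum_univ_zero]
    exact absurd (by rw [← mul_one (c 0), h, mul_zero]) (hcs.ne_zero 0)
  · have h : d 0 = 1 := by rw [← hd.complete, Fin.sum_univ_one]
    have h01 := hcs.orthogonal 1 0 (by decide)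
    have h1 := (hd.primitive 0).primitive (c 0) (1 - c 0) (hcs.idem 0)
      (one_sub_mul_one_sub (hcs.idem 0)) (by rw [h]; abel)
    rcases h1 with h1 | h1
    · exact absurd h1 (hcs.ne_zero 0)
    · rw [← sub_eq_zero.1 h1, mul_one] at h01
      exact absurd h01 (hcs.ne_zero 1)
  · exact (hB.not_frame_two_three hd hc).elim
  · rfl

/-- The inner product normalized to take the value `1` on primitive idempotents. -/
theorem exists_normalized (hE : IsEuclidean A) (hr : HasRank A 3) {c : Fin 3 → A}
    (hc : IsJordanFrame c) :
    ∃ B : A →ₗ[ℝ] A →ₗ[ℝ] ℝ, IsAssociativeInner B ∧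
      ∀ (r : ℕ) (d : Fin r → A), IsJordanFrame d → r = 3 ∧ ∀ i, B (d i) 1 = 1 := by
  obtain ⟨B, h1, h2, h3⟩ := hE
  have hB : IsAssociativeInner B := ⟨h1, h2, h3⟩
  have hone : 0 < B 1 1 := by
    refine hB.pos 1 fun h => hc.isCompleteSystem.ne_zero 0 ?_
    rw [← mul_one (c 0), h, mul_zero]
  refine ⟨(3 / B 1 1) • B, ⟨fun x y => ?_, fun x hx => ?_, fun x y z => ?_⟩, fun r d hd => ?_⟩
  · simp only [LinearMap.smul_apply, h1 x y]
  · exact mul_pos (by positivity) (h2 x hx)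
  · simp only [LinearMap.smul_apply, h3 x y z]
  · obtain rfl := hB.frame_length hr hc hd
    refine ⟨rfl, fun i => ?_⟩
    have h := hB.length_mul_apply_one hd i
    push_cast at h
    rw [LinearMap.smul_apply, LinearMap.smul_apply, smul_eq_mul]
    field_simp
    exact h

end Rank

/-! ### The subalgebra A_0 -/

section PeirceZero

variable {A : Type*} [NonAssocCommRing A] [Module ℝ A] [SMulCommClass ℝ A A]
  [IsScalarTower ℝ A A] [IsCommJordan A] {c : A} {hc : IsIdempotentElem c}

instance : IsCommJordan (peirceZero c hc) where
  lmul_comm_rmul_rmul a b := Subtype.ext (IsCommJordan.lmul_comm_rmul_rmul (a : A) (b : A))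

/-- The inclusion of `A_0` as a linear map. -/
def peirceZeroVal (c : A) (hc : IsIdempotentElem c) : peirceZero c hc →ₗ[ℝ] A where
  toFun := Subtype.val
  map_add' _ _ := rfl
  map_smul' _ _ := rfl

instance [Module.Finite ℝ A] : Module.Finite ℝ (peirceZero c hc) :=
  Module.Finite.of_injective (peirceZeroVal c hc) Subtype.val_injective

theorem coe_sum_smul {r : ℕ} (l : Fin r → ℝ) (d : Fin r → peirceZero c hc) :
    ((∑ i, l i • d i : peirceZero c hc) : A) = ∑ i, l i • (d i : A) := by
  change peirceZeroVal c hc _ = _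
  simp only [map_sum, map_smul]
  rfl

theorem isIdempotentElem_coe_iff {d : peirceZero c hc} :
    IsIdempotentElem (d : A) ↔ IsIdempotentElem d :=
  ⟨fun h => Subtype.ext h, fun h => congrArg Subtype.val h⟩

/-- The summands of a splitting of `d` in `A` lie in A_1(d), which `c` in A_0(d) annihilates, so the
splitting already takes place in A_0(c). -/
theorem IsPrimitiveIdempotent.coe {d : peirceZero c hc} (hd : IsPrimitiveIdempotent d) :
    IsPrimitiveIdempotent (d : A) := by
  have hdd : (d : A) * d = d := isIdempotentElem_coe_iff.2 hd.idem
  have hcd : c * (d : A) = 0 := mem_peirceZero.1 d.2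
  refine ⟨hdd, fun h => hd.ne_zero (Subtype.ext h), fun a b ha hb hab => ?_⟩
  have hab0 : a * b = 0 := mul_eq_zero_of_add_idem ha hb (by rw [hab, hdd])
  have hda : (d : A) * a = a := by rw [← hab, add_mul, ha.eq, mul_comm b, hab0, add_zero]
  have hdb : (d : A) * b = b := by rw [← hab, add_mul, hb.eq, hab0, zero_add]
  have hca : c * a = 0 := mul_eq_zero_of_peirce hdd (by rw [mul_comm, hcd]) hda
  have hcb : c * b = 0 := mul_eq_zero_of_peirce hdd (by rw [mul_comm, hcd]) hdb
  have h := hd.primitive ⟨a, mem_peirceZero.2 hca⟩ ⟨b, mem_peirceZero.2 hcb⟩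
    (Subtype.ext ha) (Subtype.ext hb) (Subtype.ext hab)
  exact h.imp (congrArg Subtype.val) (congrArg Subtype.val)

/-- A Jordan frame of `A_0(c)` together with `c` is a Jordan frame of `A`. -/
theorem IsJordanFrame.snoc (hcp : IsPrimitiveIdempotent c) {r : ℕ} {d : Fin r → peirceZero c hc}
    (hd : IsJordanFrame d) :
    IsJordanFrame (Fin.snoc (α := fun _ => A) (fun i => (d i : A)) c) := by
  refine ⟨fun i => ?_, fun i j hij => ?_, ?_⟩
  · refine Fin.lastCases ?_ (fun i => ?_) i
    · simpa using hcp
    · simpa using (hd.primitive i).coe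
  · have h0 : ∀ i, c * (d i : A) = 0 := fun i => mem_peirceZero.1 (d i).2
    induction i using Fin.lastCases with
    | last =>
      induction j using Fin.lastCases with
      | last => exact absurd rfl hij
      | cast j => simpa using h0 j
    | cast i =>
      induction j using Fin.lastCases with
      | last => simpa [mul_comm _ c] using h0 i
      | cast j =>
        simpa using congrArg Subtype.val (hd.orthogonal i j fun h => hij (h ▸ rfl))
  · rw [Fin.sum_univ_castSucc]
    simp only [Fin.snoc_castSucc, Fin.snoc_last]
    have h : (∑ i, (d i : A)) = 1 - c := by
      have h1 := coe_sum_smul (fun _ => 1) d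
      simp only [one_smul, hd.complete] at h1
      exact h1.symm
    rw [h, sub_add_cancel]

theorem isEuclidean_peirceZero (hE : IsEuclidean A) : IsEuclidean (peirceZero c hc) := by
  obtain ⟨B, h1, h2, h3⟩ := hE
  exact ⟨B.compl₁₂ (peirceZeroVal c hc) (peirceZeroVal c hc), fun x y => h1 _ _,
    fun x hx => h2 _ fun h => hx (Subtype.ext h), fun x y z => h3 _ _ _⟩

end PeirceZero

/-! ### Traces and Newton's identities -/

section Trace

variable {A : Type*} [NonAssocCommRing A] [Module ℝ A] [SMulCommClass ℝ A A]
  [IsScalarTower ℝ A A] {B : A →ₗ[ℝ] A →ₗ[ℝ] ℝ}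

/-- Power sums of the eigenvalues. -/
theorem IsAssociativeInner.power_sums (hB : IsAssociativeInner B) {r : ℕ} {d : Fin r → A}
    (hd : IsCompleteSystem d) (h : ∀ i, B (d i) 1 = 1) (l : Fin r → ℝ) :
    B (∑ i, l i • d i) (∑ i, l i • d i) = ∑ i, l i ^ 2 ∧
      B (∑ i, l i • d i) ((∑ i, l i • d i) * ∑ i, l i • d i) = ∑ i, l i ^ 3 := by
  constructor
  · rw [← hB.mul_apply_one, hd.sum_smul_mul_sum_smul, sum_apply_one h]
    exact Finset.sum_congr rfl fun i _ => by ring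
  · rw [← hB.mul_apply_one, hd.sum_smul_mul_sum_smul, hd.sum_smul_mul_sum_smul, sum_apply_one h]
    exact Finset.sum_congr rfl fun i _ => by ring

variable [IsCommJordan A] [Module.Finite ℝ A]

theorem IsAssociativeInner.trace_eq (hB : IsAssociativeInner B)
    (h : ∀ (r : ℕ) (d : Fin r → A), IsJordanFrame d → r = 3 ∧ ∀ i, B (d i) 1 = 1) (x : A) :
    trace x = B x 1 := by
  obtain ⟨r, d, l, hd, hx, hs⟩ := hB.hasEigenvalues_eigenvalues x
  rw [trace, hs, hx, sum_apply_one (h r d hd).2]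
  rfl

end Trace

/-- Newton's identities applied to the Peirce decomposition. -/
theorem sum_inv_eq_div {a b e p q t N M W : ℝ} (ha : 0 < a) (hb : 0 < b) (he : 0 < e)
    (h1 : a + b + e = p + q + t) (h2 : a ^ 2 + b ^ 2 + e ^ 2 = p ^ 2 + q ^ 2 + N + t ^ 2)
    (h3 : a ^ 3 + b ^ 3 + e ^ 3 = p ^ 3 + q ^ 3 + t ^ 3 + 3 * M + 3 / 2 * t * N)
    (h4 : p * q * W = (p + q) * N / 2 - M) :
    2 * (p * q) * (t - W) ≠ 0 ∧
      a⁻¹ + b⁻¹ + e⁻¹ = (2 * (p * q) + 2 * t * (p + q) - N) / (2 * (p * q) * (t - W)) := by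
  have e2 : 2 * (p * q) + 2 * t * (p + q) - N = 2 * (a * b + b * e + a * e) := by
    linear_combination h2 - (a + b + e + p + q + t) * h1
  -- Newton: 6e₃ = p₁³ - 3p₁p₂ + 2p₃; `h4` eliminates `M` in favour of `W`.
  have e3 : 2 * (p * q) * (t - W) = 2 * (a * b * e) := by
    have h5 : 6 * (a * b * e) = (a + b + e) ^ 3 - 3 * (a + b + e) * (a ^ 2 + b ^ 2 + e ^ 2) +
      2 * (a ^ 3 + b ^ 3 + e ^ 3) := by ring
    rw [h1, h2, h3] at h5
    linear_combination -2 * h4 - h5 / 3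
  rw [e2, e3]
  refine ⟨by positivity, ?_⟩
  field_simp
  ring

end EuclideanJordan

/-! ### The trace formula -/

theorem mainTheorem4 {A : Type*} [NonAssocCommRing A] [Module ℝ A] [SMulCommClass ℝ A A]
    [IsScalarTower ℝ A A] [Module.Finite ℝ A] [IsCommJordan A] [IsSimpleRing A]
    (hE : EuclideanJordan.IsEuclidean A) (hr : EuclideanJordan.HasRank A 3)
    (c : Fin 3 → A) (hc : EuclideanJordan.IsJordanFrame c)
    (z : EuclideanJordan.peirceZero (c 2) (hc.primitive 2).idem)
    (ξ : A) (hξ : ξ ∈ EuclideanJordan.peirceSpace (c 2) (1 / 2)) (t : ℝ) (y : A)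
    (hy : y = (z : A) + ξ + t • c 2) (hyΩ : y ∈ EuclideanJordan.positiveCone A) :
    EuclideanJordan.IsInvertible y ∧ EuclideanJordan.IsInvertible z ∧
    2 * EuclideanJordan.det z *
      (t - EuclideanJordan.traceForm ((EuclideanJordan.inv z).val * ξ) ξ) ≠ 0 ∧
    EuclideanJordan.trace (EuclideanJordan.inv y) =
      (2 * EuclideanJordan.det z + 2 * t * EuclideanJordan.trace z
          - EuclideanJordan.traceForm ξ ξ) /
        (2 * EuclideanJordan.det z *
          (t - EuclideanJordan.traceForm ((EuclideanJordan.inv z).val * ξ) ξ)) := by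
  open EuclideanJordan in
  obtain ⟨B, hB, hnorm⟩ := exists_normalized hE hr hc
  obtain ⟨B₀, h₀⟩ := isEuclidean_peirceZero (c := c 2) (hc := (hc.primitive 2).idem) hE
  obtain ⟨r, d, l, hd, hz, hzs⟩ := IsAssociativeInner.hasEigenvalues_eigenvalues
    (⟨h₀.1, h₀.2.1, h₀.2.2⟩ : IsAssociativeInner B₀) z
  -- Adjoining c₃ gives a frame of `A`, so `z` has exactly two eigenvalues and `B` has value 1 on
  -- their idempotents.
  have hsnoc := hd.snoc (hc.primitive 2)
  obtain ⟨hr3, hd1⟩ := hnorm _ _ hsnoc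
  obtain rfl : r = 2 := by omega
  have hd1' : ∀ i, B (d i) 1 = 1 := fun i => by simpa using hd1 i.castSucc
  obtain ⟨s, ⟨r, e, m, he, hye, rfl⟩, hs⟩ := hyΩ
  obtain ⟨rfl, he1⟩ := hnorm r e he
  have hm : ∀ i, 0 < m i := fun i => hs _ (Multiset.mem_map_of_mem m (Finset.mem_univ i))
  have hes := he.isCompleteSystem
  have hds := hd.isCompleteSystem
  have hcc : c 2 * c 2 = c 2 := (hc.primitive 2).idem
  have hcz : ∀ u : peirceZero (c 2) (hc.primitive 2).idem, c 2 * (u : A) = 0 :=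
    fun u => mem_peirceZero.1 u.2
  rw [mem_peirceSpace] at hξ
  have hc1 : B (c 2) 1 = 1 := (hnorm 3 c hc).2 2
  have hzA : (z : A) = ∑ i, l i • (d i : A) := by rw [hz, coe_sum_smul]
  -- ξ and c₃ are orthogonal to A_0, so B(y,d_i) = B(z,d_i) = l i.
  have hl : ∀ i, 0 < l i := fun i => by
    have hdd : (d i : A) * d i = d i := isIdempotentElem_coe_iff.2 (hd.primitive i).idem
    have h := hB.apply_idem_pos hes hm hdd (hd.primitive i).coe.ne_zero
    have hdi0 : c 2 * (d i : A) = (0 : ℝ) • (d i : A) := by rw [hcz, zero_smul]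
    have hzd : (z : A) * d i = l i • (d i : A) := by
      rw [mul_comm]
      have := congrArg Subtype.val (hds.mul_sum_smul l i)
      rw [← hz] at this
      exact this
    rw [← hye, hy, map_add, map_add, map_smul, LinearMap.add_apply, LinearMap.add_apply,
      LinearMap.smul_apply, hB.apply_eq_zero hξ hdi0 (by norm_num),
      hB.apply_eq_zero (u := c 2) (a := 1) (by rw [hcc, one_smul]) hdi0 (by norm_num),
      ← hB.mul_apply_one,
      hzd, map_smul, LinearMap.smul_apply, hd1'] at h
    simpa using h
  have hl0 : ∀ i, l i ≠ 0 := fun i => (hl i).ne'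
  have hm0 : ∀ i, m i ≠ 0 := fun i => (hm i).ne'
  have hzinv : ((inv z : peirceZero (c 2) (hc.primitive 2).idem) : A) =
      ∑ i, (l i)⁻¹ • (d i : A) := by
    rw [hz, hds.inv_eq hl0, coe_sum_smul]
  have hdsum : (d 0 : A) + d 1 = 1 - c 2 := by
    have h := hd.complete
    rw [Fin.sum_univ_two] at h
    exact congrArg Subtype.val h
  -- Cayley-Hamilton in A_0, whose unit is `1 - c 2`.
  have hadj : (l 0 * l 1) • ((inv z : peirceZero (c 2) (hc.primitive 2).idem) : A) =
      (l 0 + l 1) • (1 - c 2) - (z : A) := by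
    rw [hzinv, hzA, Fin.sum_univ_two, Fin.sum_univ_two, ← hdsum, smul_add, smul_smul, smul_smul,
      mul_inv_cancel_right₀ (hl0 1), mul_comm (l 0), mul_inv_cancel_right₀ (hl0 0)]
    module
  have hW : l 0 * l 1 * B ((inv z).val * ξ) ξ = (l 0 + l 1) * B ξ ξ / 2 - B ((z : A) * ξ) ξ := by
    have h := congrArg (fun u => B (u * ξ) ξ) hadj
    simp only [smul_mul_assoc, sub_mul, one_mul, hξ, map_sub, map_smul, LinearMap.sub_apply,
      LinearMap.smul_apply, smul_eq_mul] at h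
    rw [h]
    ring
  have hdet : det z = l 0 * l 1 := by
    rw [det, hzs]
    exact Fin.prod_univ_two l
  have htr : trace z = l 0 + l 1 := by
    rw [trace, hzs]
    exact Fin.sum_univ_two l
  have hzz : ∀ u v : peirceZero (c 2) (hc.primitive 2).idem, ((u * v : peirceZero (c 2)
    (hc.primitive 2).idem) : A) = (u : A) * v := fun _ _ => rfl
  have hz1 : B (z : A) 1 = l 0 + l 1 := by
    rw [hzA, sum_apply_one hd1', Fin.sum_univ_two]
  have hz2 : B (z : A) (z : A) = l 0 ^ 2 + l 1 ^ 2 := by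
    rw [← hB.mul_apply_one, ← hzz, hz, hds.sum_smul_mul_sum_smul, coe_sum_smul,
      sum_apply_one hd1', Fin.sum_univ_two]
    ring
  have hz3 : B (z : A) ((z : A) * z) = l 0 ^ 3 + l 1 ^ 3 := by
    rw [← hB.mul_apply_one, ← hzz, ← hzz, hz, hds.sum_smul_mul_sum_smul,
      hds.sum_smul_mul_sum_smul, coe_sum_smul, sum_apply_one hd1', Fin.sum_univ_two]
    ring
  have hp1 : m 0 + m 1 + m 2 = l 0 + l 1 + t := by
    rw [← Fin.sum_univ_three m, ← sum_apply_one he1, ← hye, hy, map_add, map_add, map_smul,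
      LinearMap.add_apply, LinearMap.add_apply, LinearMap.smul_apply, hB.apply_half_one hcc hξ,
      hc1, hz1, smul_eq_mul, mul_one, add_zero]
  obtain ⟨hy2, hy3⟩ := hB.power_sums hes he1 m
  rw [← hye, hy, hB.peirce_sq hcc (hcz z) hξ hc1, hz2, Fin.sum_univ_three] at hy2
  rw [← hye, hy, hB.peirce_cube hcc (hcz z) hξ hc1, hz3, Fin.sum_univ_three] at hy3
  have htrinv : trace (inv y) = (m 0)⁻¹ + (m 1)⁻¹ + (m 2)⁻¹ := by
    rw [hB.trace_eq hnorm, hye, hes.inv_eq hm0, sum_apply_one he1, Fin.sum_univ_three]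
  have hform : ∀ u v : A, traceForm u v = B u v := fun u v => by
    rw [traceForm, hB.trace_eq hnorm, hB.mul_apply_one]
  refine ⟨hye ▸ ⟨_, hes.isInverse hm0⟩, hz ▸ ⟨_, hds.isInverse hl0⟩, ?_⟩
  rw [htrinv, hform, hform, hdet, htr]
  exact sum_inv_eq_div (hm 0) (hm 1) (hm 2) hp1 hy2.symm hy3.symm hW
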